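/- Let $(\mathcal S,\mathcal A,\mathrm P,r,\gamma)$ be a Markov decision process with finite state set $\mathcal S$, finite action set $\mathcal A$, transition probabilities $\mathrm P(s,a,s')$ and transition-based discount $\gamma:\mathcal S\times\mathcal A\times\mathcal S\to[0,1]$. On a transition from $S_t$ to $S_{t+1}$ under $A_t$ the reward $R_{t+1}$ is drawn, independently of the past given $(S_t,A_t,S_{t+1})$, from a law that depends only on $(S_t,A_t,S_{t+1})$ and has finite mean $r(S_t,A_t,S_{t+1})$; put $\gamma_{t+1}=\gamma(S_t,A_t,S_{t+1})$. Let $\pi(\cdot,\cdot;\theta)$, $\theta\in\mathbb R^d$, be target policies, differentiable in $\theta$. Fix $\theta$ and write $\pi=\pi(\cdot,\cdot;\theta)$, $$v_\pi(s)=\mathbb E_\pi[G_0\mid S_0=s],\qquad q_\pi(s,a)=\mathbb E_\pi[G_0\mid S_0=s,A_0=a],\qquad G_0=R_1+\gamma_1R_2+\gamma_1\gamma_2R_3+\cdots,$$ $$\mathbf P_{\pi,\gamma}(s,s')=\sum_a\pi(s,a)\,\mathrm P(s,a,s')\,\gamma(s,a,s').$$ Let $\mu$ be a behaviour policy and suppose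 that (Yu, 2015) $\mathbf I-\mathbf P_{\pi,\gamma}$ is invertible, the Markov chain on $\mathcal S$ induced by $\mu$ is irreducible, and $\mu(s,a)=0$ implies $\pi(s,a)=0$. Let $S_0$ have some initial distribution (for example a fixed state $s_0$), let all actions be selected by $\mu$, and suppose that the limiting distribution $d_\mu(s)=\lim_{t\to\infty}\mathrm P(S_t=s)$ exists. Let $i:\mathcal S\to[0,\infty)$ and $\lambda_a\in[0,1]$, and put $$\rho_t=\frac{\pi(S_t,A_t)}{\mu(S_t,A_t)},\qquad \delta_t=R_{t+1}+\gamma_{t+1}v_\pi(S_{t+1})-v_\pi(S_t),$$ $$F_0=0,\qquad F_t=\gamma_t\rho_{t-1}F_{t-1}+i(S_t),\qquad M_t=(1-\lambda_a)\,i(S_t)+\lambda_aF_t .$$ With the vector $\mathbf i(s)=d_\mu(s)\,i(s)$ define $$\mathbf m_{\lambda_a}^\top=\mathbf i^\top(\mathbf I-\mathbf P_{\pi,\gamma})^{-1}\bigl(\mathbf I-(1-\lambda_a)\mathbf P_{\pi,\gamma}\bigr),\qquad \mathbf m^\top=\mathbf i^\top(\mathbf I-\mathbf P_{\pi,\gamma})^{-1}.$$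 Then, for every $\lambda_a\in[0,1]$, the update $\rho_tM_t\delta_t\nabla_\theta\ln\pi(S_t,A_t;\theta)$ is integrable for every $t$, and its steady-state expectation under $\mu$ is $$\lim_{t\to\infty}\mathbb E_\mu\bigl[\rho_tM_t\delta_t\nabla_\theta\ln\pi(S_t,A_t;\theta)\bigr]=\sum_s m_{\lambda_a}(s)\sum_a\frac{\partial\pi(s,a;\theta)}{\partial\theta}\,q_\pi(s,a).$$ In particular, for $\lambda_a=1$ it equals the off-policy gradient $\sum_s m(s)\sum_a\frac{\partial\pi(s,a;\theta)}{\partial\theta}\,q_\pi(s,a)$. -/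

import Mathlib

open MeasureTheory ProbabilityTheory Filter Topology

noncomputable section

namespace OffPolicy

/-- A finite Markov decision process with transition-based discounting. `P s a` is the law of the
next state, `rewardLaw s a s'` the law of the (random) reward emitted on the transition
`(s, a, s')`, assumed to have a finite mean, and `γ s a s'` the discount of that transition. -/
structure MDP (S A : Type*) where
  P : S → A → PMF S
  rewardLaw : S → A → S → Measure ℝ
  isProbabilityMeasure_rewardLaw : ∀ s a s', IsProbabilityMeasure (rewardLaw s a s')
  integrable_reward : ∀ s a s', Integrable (fun x : ℝ => x) (rewardLaw s a s')
  γ : S → A → S → ℝ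
  γ_nonneg : ∀ s a s', 0 ≤ γ s a s'
  γ_le_one : ∀ s a s', γ s a s' ≤ 1

/-- What is recorded at time `t`: the triple `(R_t, S_t, A_t)`. -/
abbrev Obs (S A : Type*) := ℝ × S × A

/-- Trajectories `(R_t, S_t, A_t)_{t ≥ 0}`; the coordinate `R_0` is a dummy. -/
abbrev Path (S A : Type*) := ℕ → Obs S A

section Processes

variable {S A : Type*}

/-- The state `S_t`. -/
def stateAt (t : ℕ) (ω : Path S A) : S := (ω t).2.1

/-- The action `A_t`. -/
def actionAt (t : ℕ) (ω : Path S A) : A := (ω t).2.2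

/-- The reward `R_t` (meaningful for `t ≥ 1`). -/
def rewardAt (t : ℕ) (ω : Path S A) : ℝ := (ω t).1

/-- The discount `γ_{t+1} = γ(S_t, A_t, S_{t+1})`; the index `t` here is that of the departure
state. -/
def MDP.discountAfter (M : MDP S A) (t : ℕ) (ω : Path S A) : ℝ :=
  M.γ (stateAt t ω) (actionAt t ω) (stateAt (t + 1) ω)

/-- The return `G_0 = R_1 + γ_1 R_2 + γ_1 γ_2 R_3 + ⋯`. -/
def MDP.discountedReturn (M : MDP S A) (ω : Path S A) : ℝ :=
  ∑' k : ℕ, (∏ j ∈ Finset.range k, M.discountAfter j ω) * rewardAt (k + 1) ω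

/-- The importance sampling ratio `ρ_t = π(S_t, A_t) / μ(S_t, A_t)`. -/
def ratioAt (π μ : S → PMF A) (t : ℕ) (ω : Path S A) : ℝ :=
  (π (stateAt t ω) (actionAt t ω)).toReal / (μ (stateAt t ω) (actionAt t ω)).toReal

/-- The follow-on trace: `F_0 = 0` and `F_{t+1} = γ_{t+1} ρ_t F_t + i(S_{t+1})`. -/
def MDP.followOn (M : MDP S A) (π μ : S → PMF A) (i : S → ℝ) : ℕ → Path S A → ℝ
  | 0, _ => 0
  | t + 1, ω => M.discountAfter t ω * ratioAt π μ t ω * M.followOn π μ i t ω + i (stateAt (t + 1) ω)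

/-- The emphasis `M_t = (1 - λ) i(S_t) + λ F_t`. -/
def MDP.emphasis (M : MDP S A) (π μ : S → PMF A) (i : S → ℝ) (lam : ℝ) (t : ℕ)
    (ω : Path S A) : ℝ :=
  (1 - lam) * i (stateAt t ω) + lam * M.followOn π μ i t ω

/-- The temporal difference error `δ_t = R_{t+1} + γ_{t+1} v(S_{t+1}) - v(S_t)`. -/
def MDP.tdError (M : MDP S A) (v : S → ℝ) (t : ℕ) (ω : Path S A) : ℝ :=
  rewardAt (t + 1) ω + M.discountAfter t ω * v (stateAt (t + 1) ω) - v (stateAt t ω)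

end Processes

section

variable {S A : Type*} [Fintype S] [Fintype A]

/-- The law of `(R_{t+1}, S_{t+1}, A_{t+1})` given `(S_t, A_t) = (s, a)` when actions are selected
by the policy `b`: the next state `s'` is drawn from `P s a`, the reward from `rewardLaw s a s'`,
the next action from `b s'`. -/
def MDP.stepLaw [MeasurableSpace S] [MeasurableSpace A] (M : MDP S A) (b : S → PMF A)
    (x : S × A) : Measure (Obs S A) :=
  ∑ s' : S, ∑ a' : A, (M.P x.1 x.2 s' * b s' a') •
    (M.rewardLaw x.1 x.2 s').map (fun r => ((r, s', a') : Obs S A))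

theorem pmf_sum_eq_one {B : Type*} [Fintype B] (p : PMF B) : ∑ b : B, p b = 1 := by
  rw [← tsum_fintype (L := .unconditional B)]
  exact p.tsum_coe

instance MDP.isProbabilityMeasure_stepLaw [MeasurableSpace S] [MeasurableSpace A] (M : MDP S A)
    (b : S → PMF A) (x : S × A) : IsProbabilityMeasure (M.stepLaw b x) := by
  constructor
  have h : ∀ s' a', ((M.rewardLaw x.1 x.2 s').map (fun r => ((r, s', a') : Obs S A)))
      Set.univ = 1 := by
    intro s' a'
    have := M.isProbabilityMeasure_rewardLaw x.1 x.2 s'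
    rw [Measure.map_apply (by fun_prop) MeasurableSet.univ]
    simp
  simp only [MDP.stepLaw, Measure.coe_finsetSum, Finset.sum_apply, Measure.smul_apply, h,
    smul_eq_mul, mul_one, ← Finset.mul_sum, pmf_sum_eq_one]

/-- The Markov kernel from the history up to time `n` to `(R_{n+1}, S_{n+1}, A_{n+1})`. -/
def MDP.stepKernel [MeasurableSpace S] [MeasurableSpace A] [MeasurableSingletonClass S]
    [MeasurableSingletonClass A] (M : MDP S A) (b : S → PMF A) (n : ℕ) :
    Kernel (Π _ : Finset.Iic n, Obs S A) (Obs S A) :=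
  Kernel.comap ⟨M.stepLaw b, measurable_of_finite _⟩
    (fun h => (h ⟨n, Finset.mem_Iic.2 le_rfl⟩).2) (by fun_prop)

instance MDP.isMarkovKernel_stepKernel [MeasurableSpace S] [MeasurableSpace A]
    [MeasurableSingletonClass S] [MeasurableSingletonClass A] (M : MDP S A) (b : S → PMF A)
    (n : ℕ) : IsMarkovKernel (M.stepKernel b n) :=
  ⟨fun h => M.isProbabilityMeasure_stepLaw b (h ⟨n, Finset.mem_Iic.2 le_rfl⟩).2⟩

/-- The law of `(R_0, S_0, A_0)` with `S_0` drawn from `ν`, `A_0` from `b S_0` and `R_0 = 0`. -/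
def startLaw [MeasurableSpace S] [MeasurableSpace A] (b : S → PMF A) (ν : PMF S) :
    Measure (Obs S A) :=
  ∑ s : S, ∑ a : A, (ν s * b s a) • Measure.dirac ((0, s, a) : Obs S A)

/-- The law of the whole trajectory when `S_0` is drawn from `ν` and all actions are selected
by the policy `b`. -/
def MDP.pathLaw [MeasurableSpace S] [MeasurableSpace A] [MeasurableSingletonClass S]
    [MeasurableSingletonClass A] (M : MDP S A) (b : S → PMF A) (ν : PMF S) :
    Measure (Path S A) :=
  Kernel.trajMeasure (X := fun _ => Obs S A) (startLaw b ν) (M.stepKernel b)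

/-- The law of the whole trajectory when `(S_0, A_0) = (s, a)` and all later actions are selected
by the policy `b`. -/
def MDP.pathLawFrom [MeasurableSpace S] [MeasurableSpace A] [MeasurableSingletonClass S]
    [MeasurableSingletonClass A] (M : MDP S A) (b : S → PMF A) (s : S) (a : A) :
    Measure (Path S A) :=
  Kernel.trajMeasure (X := fun _ => Obs S A) (Measure.dirac ((0, s, a) : Obs S A))
    (M.stepKernel b)

/-- The state value function `v_π(s) = E_π[G_0 | S_0 = s]`. -/
def MDP.value [MeasurableSpace S] [MeasurableSpace A] [MeasurableSingletonClass S]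
    [MeasurableSingletonClass A] (M : MDP S A) (π : S → PMF A) (s : S) : ℝ :=
  ∫ ω, M.discountedReturn ω ∂(M.pathLaw π (PMF.pure s))

/-- The action value function `q_π(s, a) = E_π[G_0 | S_0 = s, A_0 = a]`. -/
def MDP.actionValue [MeasurableSpace S] [MeasurableSpace A] [MeasurableSingletonClass S]
    [MeasurableSingletonClass A] (M : MDP S A) (π : S → PMF A) (s : S) (a : A) : ℝ :=
  ∫ ω, M.discountedReturn ω ∂(M.pathLawFrom π s a)

/-- `d` is the limiting distribution of states under the policy `b` started from `ν`:
`d(s) = lim_{t → ∞} P(S_t = s)`. -/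
def MDP.IsLimitingDistribution [MeasurableSpace S] [MeasurableSpace A]
    [MeasurableSingletonClass S] [MeasurableSingletonClass A] (M : MDP S A) (b : S → PMF A)
    (ν : PMF S) (d : S → ℝ) : Prop :=
  ∀ s, Tendsto (fun t : ℕ => (M.pathLaw b ν).real {ω | stateAt t ω = s}) atTop (𝓝 (d s))

/-- The emphatically weighted actor update `ρ_t M_t δ_t ∇_θ ln π(S_t, A_t; θ)`, where `δ_t` uses
the true value function of the target policy. -/
def MDP.actorUpdate [MeasurableSpace S] [MeasurableSpace A] [MeasurableSingletonClass S]
    [MeasurableSingletonClass A] {d : ℕ} (M : MDP S A)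
    (π : EuclideanSpace ℝ (Fin d) → S → PMF A) (θ : EuclideanSpace ℝ (Fin d)) (μ : S → PMF A)
    (i : S → ℝ) (lam : ℝ) (t : ℕ) (ω : Path S A) : EuclideanSpace ℝ (Fin d) :=
  (ratioAt (π θ) μ t ω * M.emphasis (π θ) μ i lam t ω * M.tdError (M.value (π θ)) t ω) •
    gradient (fun ϑ => Real.log (π ϑ (stateAt t ω) (actionAt t ω)).toReal) θ

end

section Matrices

variable {S A : Type*} [Fintype A]

/-- The state transition matrix of the Markov chain induced by the policy `b`. -/
def MDP.transMatrix (M : MDP S A) (b : S → PMF A) : Matrix S S ℝ :=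
  Matrix.of fun s s' => ∑ a : A, (b s a).toReal * (M.P s a s').toReal

/-- The matrix `P_{π,γ}(s, s') = ∑_a π(s, a) P(s, a, s') γ(s, a, s')`. -/
def MDP.discMatrix (M : MDP S A) (π : S → PMF A) : Matrix S S ℝ :=
  Matrix.of fun s s' => ∑ a : A, (π s a).toReal * (M.P s a s').toReal * M.γ s a s'

/-- Yu's conditions on the MDP, the target policy `π` and the behaviour policy `μ`. -/
structure MDP.YuConditions [Fintype S] [DecidableEq S] (M : MDP S A) (π μ : S → PMF A) :
    Prop where
  isUnit : IsUnit (1 - M.discMatrix π)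
  irreducible : (M.transMatrix μ).IsIrreducible
  coverage : ∀ s a, μ s a = 0 → π s a = 0

/-- The emphatic weighting `mᵀ = iᵀ (I - P_{π,γ})⁻¹`, with vector `i(s) = d(s) i(s)`. -/
def MDP.emphaticWeighting [Fintype S] [DecidableEq S] (M : MDP S A) (π : S → PMF A)
    (d i : S → ℝ) : S → ℝ :=
  Matrix.vecMul (fun s => d s * i s) (1 - M.discMatrix π)⁻¹

/-- The emphatic weighting with trace parameter,
`m_λᵀ = iᵀ (I - P_{π,γ})⁻¹ (I - (1 - λ) P_{π,γ})`. -/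
def MDP.emphaticWeightingTrace [Fintype S] [DecidableEq S] (M : MDP S A) (π : S → PMF A)
    (d i : S → ℝ) (lam : ℝ) : S → ℝ :=
  Matrix.vecMul (fun s => d s * i s)
    ((1 - M.discMatrix π)⁻¹ * (1 - (1 - lam) • M.discMatrix π))

end Matrices

end OffPolicy

end

noncomputable section

namespace OffPolicy

section Trajectories

variable {S A : Type*}

/-- `Z` is a function of the states and actions up to time `t`. -/
def IsHistoryFunction (t : ℕ) (Z : Path S A → ℝ) : Prop :=
  ∃ Y : (Finset.Iic t → S × A) → ℝ, ∀ ω, Z ω = Y fun j => (ω j).2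

/-- The indicator of the event `(S_t, A_t) = x`. -/
def visit [DecidableEq S] [DecidableEq A] (t : ℕ) (x : S × A) (ω : Path S A) : ℝ :=
  if (ω t).2 = x then 1 else 0

variable [Fintype S] [Fintype A]

theorem IsHistoryFunction.exists_bound {t : ℕ} {Z : Path S A → ℝ} (hZ : IsHistoryFunction t Z) :
    ∃ C, ∀ ω, ‖Z ω‖ ≤ C := by
  obtain ⟨Y, hY⟩ := hZ
  obtain ⟨C, hC⟩ := (Set.finite_range fun h => ‖Y h‖).bddAbove
  exact ⟨C, fun ω => hY ω ▸ hC ⟨_, rfl⟩⟩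

variable [MeasurableSpace S] [MeasurableSpace A]

theorem MDP.integrable_stepLaw (M : MDP S A) (b : S → PMF A) (x : S × A) {ψ : Obs S A → ℝ}
    (hψm : Measurable ψ)
    (hψ : ∀ s' a', Integrable (fun r => ψ (r, s', a')) (M.rewardLaw x.1 x.2 s')) :
    Integrable ψ (M.stepLaw b x) := by
  refine integrable_finsetSum_measure.2 fun s' _ => integrable_finsetSum_measure.2 fun a' _ => ?_
  refine Integrable.smul_measure ?_ (ENNReal.mul_ne_top (PMF.apply_ne_top _ _)
    (PMF.apply_ne_top _ _))
  rw [integrable_map_measure hψm.aestronglyMeasurable (by fun_prop)]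
  exact hψ s' a'

theorem MDP.integral_stepLaw (M : MDP S A) (b : S → PMF A) (x : S × A) {ψ : Obs S A → ℝ}
    (hψm : Measurable ψ)
    (hψ : ∀ s' a', Integrable (fun r => ψ (r, s', a')) (M.rewardLaw x.1 x.2 s')) :
    ∫ o, ψ o ∂(M.stepLaw b x) = ∑ s', ∑ a', (M.P x.1 x.2 s').toReal * (b s' a').toReal *
      ∫ r, ψ (r, s', a') ∂(M.rewardLaw x.1 x.2 s') := by
  have h : ∀ s' a', Integrable ψ ((M.P x.1 x.2 s' * b s' a') •
      (M.rewardLaw x.1 x.2 s').map (fun r => ((r, s', a') : Obs S A))) := by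
    intro s' a'
    refine Integrable.smul_measure ?_ (ENNReal.mul_ne_top (PMF.apply_ne_top _ _)
      (PMF.apply_ne_top _ _))
    rw [integrable_map_measure hψm.aestronglyMeasurable (by fun_prop)]
    exact hψ s' a'
  rw [MDP.stepLaw, integral_finsetSum_measure fun s' _ =>
    integrable_finsetSum_measure.2 fun a' _ => h s' a']
  refine Finset.sum_congr rfl fun s' _ => ?_
  rw [integral_finsetSum_measure fun a' _ => h s' a']
  refine Finset.sum_congr rfl fun a' _ => ?_
  rw [integral_smul_measure, integral_map (by fun_prop) hψm.aestronglyMeasurable,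
    ENNReal.toReal_mul, smul_eq_mul]

variable [MeasurableSingletonClass S] [MeasurableSingletonClass A]

instance isProbabilityMeasure_startLaw (b : S → PMF A) (ν : PMF S) :
    IsProbabilityMeasure (startLaw b ν) := by
  constructor
  simp only [startLaw, Measure.coe_finsetSum, Finset.sum_apply, Measure.smul_apply,
    measure_univ, smul_eq_mul, mul_one, ← Finset.mul_sum, pmf_sum_eq_one]

/-- The law of the trajectory with initial law `ν₀` and actions selected by `b`. -/
abbrev MDP.law (M : MDP S A) (b : S → PMF A) (ν₀ : Measure (Obs S A)) : Measure (Path S A) :=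
  Kernel.trajMeasure (X := fun _ => Obs S A) ν₀ (M.stepKernel b)

theorem map_zero_trajMeasure {X : ℕ → Type*} [∀ n, MeasurableSpace (X n)]
    (κ : (n : ℕ) → Kernel (Π i : Finset.Iic n, X i) (X (n + 1))) [∀ n, IsMarkovKernel (κ n)]
    (ν₀ : Measure (X 0)) [IsProbabilityMeasure ν₀] :
    (Kernel.trajMeasure ν₀ κ).map (fun ω => ω 0) = ν₀ := by
  have h : (fun ω : Π n, X n => ω 0) =
      (fun y : Π i : Finset.Iic 0, X i => y ⟨0, Finset.mem_Iic.2 le_rfl⟩) ∘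
        Preorder.frestrictLe 0 := rfl
  rw [h, ← Measure.map_map (by fun_prop) (by fun_prop), Kernel.trajMeasure,
    Measure.map_comp _ _ (by fun_prop), Kernel.traj_map_frestrictLe, Kernel.partialTraj_self,
    Measure.id_comp]
  exact (Measure.map_map (by fun_prop) (MeasurableEquiv.measurable _)).trans Measure.map_id

theorem IsHistoryFunction.measurable {t : ℕ} {Z : Path S A → ℝ} (hZ : IsHistoryFunction t Z) :
    Measurable Z := by
  obtain ⟨Y, hY⟩ := hZ
  rw [funext hY]
  exact (measurable_of_finite Y).comp (by fun_prop)

theorem IsHistoryFunction.integrable {t : ℕ} {Z : Path S A → ℝ} (hZ : IsHistoryFunction t Z)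
    (Q : Measure (Path S A)) [IsFiniteMeasure Q] : Integrable Z Q := by
  obtain ⟨C, hC⟩ := hZ.exists_bound
  exact Integrable.of_bound hZ.measurable.aestronglyMeasurable C (ae_of_all _ hC)

/-- The Markov property: given the history up to time `t` and `(S_t, A_t) = x`, the next
observation has law `stepLaw b x`. -/
theorem MDP.integrable_and_integral_visit_mul [DecidableEq S] [DecidableEq A] (M : MDP S A) (b : S → PMF A)
    (ν₀ : Measure (Obs S A)) [IsProbabilityMeasure ν₀] {t : ℕ} {Z : Path S A → ℝ}
    (hZ : IsHistoryFunction t Z) (x : S × A) {ψ : Obs S A → ℝ} (hψm : Measurable ψ)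
    (hψ : Integrable ψ (M.stepLaw b x)) :
    Integrable (fun ω => Z ω * visit t x ω * ψ (ω (t + 1))) (M.law b ν₀) ∧
    ∫ ω, Z ω * visit t x ω * ψ (ω (t + 1)) ∂(M.law b ν₀) =
      (∫ ω, Z ω * visit t x ω ∂(M.law b ν₀)) * ∫ o, ψ o ∂(M.stepLaw b x) := by
  obtain ⟨Y, hY⟩ := hZ
  let u : (Π _ : Finset.Iic t, Obs S A) → ℝ := fun h =>
    Y (fun j => (h j).2) * if (h ⟨t, Finset.mem_Iic.2 le_rfl⟩).2 = x then 1 else 0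
  have hu : Measurable u := by
    have : u = (fun k : Finset.Iic t → S × A =>
        Y k * if k ⟨t, Finset.mem_Iic.2 le_rfl⟩ = x then 1 else 0) ∘ fun h j => (h j).2 := rfl
    rw [this]
    exact (measurable_of_finite _).comp (by fun_prop)
  have hub : ∃ C, ∀ h, ‖u h‖ ≤ C := by
    obtain ⟨C, hC⟩ := (Set.finite_range fun k : Finset.Iic t → S × A =>
        ‖Y k * if k ⟨t, Finset.mem_Iic.2 le_rfl⟩ = x then (1 : ℝ) else 0‖).bddAbove
    exact ⟨C, fun h => hC ⟨fun j => (h j).2, rfl⟩⟩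
  obtain ⟨C, hC⟩ := hub
  have huZ : ∀ ω, Z ω * visit t x ω = u (Preorder.frestrictLe t ω) := fun ω => by
    rw [hY]; rfl
  have hu0 : ∀ h, (h ⟨t, Finset.mem_Iic.2 le_rfl⟩).2 ≠ x → u h = 0 := fun h hh => by
    simp [u, hh]
  have hk : ∀ h, M.stepKernel b t h = M.stepLaw b (h ⟨t, Finset.mem_Iic.2 le_rfl⟩).2 :=
    fun h => rfl
  set Q := M.law b ν₀
  have key := Kernel.map_frestrictLe_trajMeasure_compProd_eq_map_trajMeasure
    (X := fun _ => Obs S A) (μ₀ := ν₀) (κ := M.stepKernel b) (a := t)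
  have hfm : Measurable fun p : (Π _ : Finset.Iic t, Obs S A) × Obs S A => u p.1 * ψ p.2 := by
    fun_prop
  have : IsProbabilityMeasure (Q.map (Preorder.frestrictLe t)) :=
    Measure.isProbabilityMeasure_map (by fun_prop)
  have hint : Integrable (fun p : (Π _ : Finset.Iic t, Obs S A) × Obs S A => u p.1 * ψ p.2)
      (Q.map (Preorder.frestrictLe t) ⊗ₘ M.stepKernel b t) := by
    rw [Measure.integrable_compProd_iff hfm.aestronglyMeasurable]
    refine ⟨ae_of_all _ fun h => ?_, ?_⟩
    · by_cases hh : (h ⟨t, Finset.mem_Iic.2 le_rfl⟩).2 = x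
      · rw [hk, hh]; exact hψ.const_mul (u h)
      · simp [hu0 h hh]
    · refine Integrable.of_bound (C := C * ∫ o, ‖ψ o‖ ∂(M.stepLaw b x)) ?_ (ae_of_all _ fun h => ?_)
      · exact (hfm.stronglyMeasurable.norm.integral_kernel_prod_right'
          (κ := M.stepKernel b t)).aestronglyMeasurable
      · have hnn : 0 ≤ ∫ o, ‖ψ o‖ ∂(M.stepLaw b x) := integral_nonneg fun _ => norm_nonneg _
        have hC0 : 0 ≤ C := (norm_nonneg _).trans (hC h)
        simp only [norm_mul, integral_const_mul]
        by_cases hh : (h ⟨t, Finset.mem_Iic.2 le_rfl⟩).2 = x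
        · rw [hk, hh, norm_norm, Real.norm_of_nonneg hnn]
          exact mul_le_mul_of_nonneg_right (hC h) hnn
        · simp only [hu0 h hh, norm_zero, zero_mul]; positivity
  have hpair : Measurable fun ω : Path S A => (Preorder.frestrictLe (π := fun _ => Obs S A) t ω,
      ω (t + 1)) := by fun_prop
  constructor
  · rw [key] at hint
    simp only [huZ]
    exact hint.comp_measurable hpair
  · have e1 : ∫ ω, Z ω * visit t x ω * ψ (ω (t + 1)) ∂Q =
        ∫ p, u p.1 * ψ p.2 ∂(Q.map (Preorder.frestrictLe t) ⊗ₘ M.stepKernel b t) := by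
      rw [key, integral_map hpair.aemeasurable hfm.aestronglyMeasurable]
      simp only [huZ]
      rfl
    rw [e1, Measure.integral_compProd hint]
    have e2 : ∀ h, ∫ o, u h * ψ o ∂(M.stepKernel b t h) = u h * ∫ o, ψ o ∂(M.stepLaw b x) := by
      intro h
      rw [integral_const_mul]
      by_cases hh : (h ⟨t, Finset.mem_Iic.2 le_rfl⟩).2 = x
      · rw [hk, hh]
      · simp [hu0 h hh]
    simp only [e2]
    rw [integral_mul_const, integral_map (by fun_prop) hu.aestronglyMeasurable]
    simp only [huZ]

end Trajectories

section Moments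

theorem startLaw_real {S A : Type*} [Fintype S] [Fintype A]
    [MeasurableSpace S] [MeasurableSpace A] [MeasurableSingletonClass S]
    [MeasurableSingletonClass A] (b : S → PMF A) (ν : PMF S) (x : S × A) :
    (startLaw b ν).real {o | o.2 = x} = (ν x.1).toReal * (b x.1 x.2).toReal := by
  have hm : MeasurableSet {o : Obs S A | o.2 = x} := measurable_snd (measurableSet_singleton x)
  rw [measureReal_def, startLaw, ← ENNReal.toReal_mul]
  congr 1
  simp only [Measure.coe_finsetSum, Finset.sum_apply, Measure.smul_apply,
    Measure.dirac_apply' _ hm, smul_eq_mul]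
  rw [← Fintype.sum_prod_type' (f := fun s a => ν s * b s a *
    Set.indicator {o : Obs S A | o.2 = x} 1 ((0, s, a) : Obs S A)), Finset.sum_eq_single x]
  · simp
  · intro y _ hy
    simp [hy]
  · simp

variable {S A : Type*}

/-- The trace `Z_0 = z₀`, `Z_{t+1} = c(S_t, A_t, S_{t+1}) Z_t + e(S_{t+1})`. -/
def linearTrace (c : S → A → S → ℝ) (e : S → ℝ) (z₀ : ℝ) : ℕ → Path S A → ℝ
  | 0, _ => z₀
  | t + 1, ω => c (stateAt t ω) (actionAt t ω) (stateAt (t + 1) ω) * linearTrace c e z₀ t ω +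
      e (stateAt (t + 1) ω)

theorem isHistoryFunction_of_current (t : ℕ) (f : S × A → ℝ) :
    IsHistoryFunction t fun ω : Path S A => f (ω t).2 :=
  ⟨fun k => f (k ⟨t, Finset.mem_Iic.2 le_rfl⟩), fun _ => rfl⟩

theorem IsHistoryFunction.mul {t : ℕ} {Z W : Path S A → ℝ} (hZ : IsHistoryFunction t Z)
    (hW : IsHistoryFunction t W) : IsHistoryFunction t fun ω => Z ω * W ω := by
  obtain ⟨Y, hY⟩ := hZ
  obtain ⟨V, hV⟩ := hW
  exact ⟨fun k => Y k * V k, fun ω => by simp only [hY, hV]⟩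

theorem IsHistoryFunction.add {t : ℕ} {Z W : Path S A → ℝ} (hZ : IsHistoryFunction t Z)
    (hW : IsHistoryFunction t W) : IsHistoryFunction t fun ω => Z ω + W ω := by
  obtain ⟨Y, hY⟩ := hZ
  obtain ⟨V, hV⟩ := hW
  exact ⟨fun k => Y k + V k, fun ω => by simp only [hY, hV]⟩

theorem isHistoryFunction_const (t : ℕ) (z : ℝ) : IsHistoryFunction t fun _ : Path S A => z :=
  ⟨fun _ => z, fun _ => rfl⟩

theorem IsHistoryFunction.mono {t u : ℕ} (htu : t ≤ u) {Z : Path S A → ℝ}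
    (hZ : IsHistoryFunction t Z) : IsHistoryFunction u Z := by
  obtain ⟨Y, hY⟩ := hZ
  exact ⟨fun k => Y fun j => k ⟨j, Finset.mem_Iic.2 ((Finset.mem_Iic.1 j.2).trans htu)⟩, hY⟩

theorem isHistoryFunction_transition (t : ℕ) (c : S → A → S → ℝ) : IsHistoryFunction (t + 1)
    fun ω : Path S A => c (stateAt t ω) (actionAt t ω) (stateAt (t + 1) ω) :=
  ⟨fun k => c (k ⟨t, Finset.mem_Iic.2 t.le_succ⟩).1 (k ⟨t, Finset.mem_Iic.2 t.le_succ⟩).2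
    (k ⟨t + 1, Finset.mem_Iic.2 le_rfl⟩).1, fun _ => rfl⟩

theorem isHistoryFunction_linearTrace (c : S → A → S → ℝ) (e : S → ℝ) (z₀ : ℝ) (t : ℕ) :
    IsHistoryFunction t (linearTrace c e z₀ t : Path S A → ℝ) := by
  induction t with
  | zero => exact isHistoryFunction_const 0 z₀
  | succ t ih =>
    exact ((isHistoryFunction_transition t c).mul (ih.mono t.le_succ)).add
      (isHistoryFunction_of_current (t + 1) fun x => e x.1)

variable [DecidableEq S] [DecidableEq A]

theorem isHistoryFunction_visit (t : ℕ) (x : S × A) :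
    IsHistoryFunction t (visit t x : Path S A → ℝ) :=
  isHistoryFunction_of_current t fun y => if y = x then 1 else 0

variable [Fintype S] [Fintype A] [MeasurableSpace S] [MeasurableSpace A]
  [MeasurableSingletonClass S] [MeasurableSingletonClass A]

/-- The moment `E[Z 1{(S_t, A_t) = x}]`. -/
def MDP.moment (M : MDP S A) (b : S → PMF A) (ν₀ : Measure (Obs S A)) (t : ℕ) (Z : Path S A → ℝ)
    (x : S × A) : ℝ :=
  ∫ ω, Z ω * visit t x ω ∂(M.law b ν₀)

variable (M : MDP S A) (b : S → PMF A) (ν₀ : Measure (Obs S A))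

theorem MDP.moment_const_mul (t : ℕ) (z : ℝ) (Z : Path S A → ℝ) (x : S × A) :
    M.moment b ν₀ t (fun ω => z * Z ω) x = z * M.moment b ν₀ t Z x := by
  simp only [MDP.moment, mul_assoc, integral_const_mul]

theorem MDP.moment_current_mul (t : ℕ) (f : S × A → ℝ) (Z : Path S A → ℝ) (x : S × A) :
    M.moment b ν₀ t (fun ω => f (ω t).2 * Z ω) x = f x * M.moment b ν₀ t Z x := by
  rw [← M.moment_const_mul, MDP.moment, MDP.moment]
  congr 1 with ω
  by_cases h : (ω t).2 = x <;> simp [visit, h]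

variable [IsProbabilityMeasure ν₀]

theorem MDP.integrable_and_integral_step_smul {E : Type*} [NormedAddCommGroup E] [NormedSpace ℝ E]
    [CompleteSpace E] {t : ℕ} {Z : Path S A → ℝ} (hZ : IsHistoryFunction t Z)
    {ψ : S × A → Obs S A → ℝ} (hψm : ∀ x, Measurable (ψ x))
    (hψ : ∀ x, Integrable (ψ x) (M.stepLaw b x)) (G : S × A → E) :
    Integrable (fun ω => (Z ω * ψ (ω t).2 (ω (t + 1))) • G (ω t).2) (M.law b ν₀) ∧
    ∫ ω, (Z ω * ψ (ω t).2 (ω (t + 1))) • G (ω t).2 ∂(M.law b ν₀) =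
      ∑ x, (M.moment b ν₀ t Z x * ∫ o, ψ x o ∂(M.stepLaw b x)) • G x := by
  have h : ∀ ω : Path S A, (Z ω * ψ (ω t).2 (ω (t + 1))) • G (ω t).2 =
      ∑ x, (Z ω * visit t x ω * ψ x (ω (t + 1))) • G x := fun ω => by
    rw [Finset.sum_eq_single (ω t).2]
    · simp [visit]
    · intro x _ hx
      simp [visit, hx.symm]
    · simp
  have hx := fun x => M.integrable_and_integral_visit_mul b ν₀ hZ x (hψm x) (hψ x)
  simp only [h]
  refine ⟨integrable_finsetSum _ fun x _ => (hx x).1.smul_const _, ?_⟩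
  rw [integral_finsetSum _ fun x _ => (hx x).1.smul_const _]
  exact Finset.sum_congr rfl fun x _ => by rw [integral_smul_const, (hx x).2, MDP.moment]

theorem MDP.integrable_and_integral_step_mul {t : ℕ} {Z : Path S A → ℝ}
    (hZ : IsHistoryFunction t Z)
    {ψ : S × A → Obs S A → ℝ} (hψm : ∀ x, Measurable (ψ x))
    (hψ : ∀ x, Integrable (ψ x) (M.stepLaw b x)) :
    Integrable (fun ω => Z ω * ψ (ω t).2 (ω (t + 1))) (M.law b ν₀) ∧
    ∫ ω, Z ω * ψ (ω t).2 (ω (t + 1)) ∂(M.law b ν₀) =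
      ∑ x, M.moment b ν₀ t Z x * ∫ o, ψ x o ∂(M.stepLaw b x) := by
  simpa using M.integrable_and_integral_step_smul b ν₀ hZ hψm hψ fun _ => (1 : ℝ)

theorem MDP.moment_transition_mul {t : ℕ} {Z : Path S A → ℝ} (hZ : IsHistoryFunction t Z)
    (c : S → A → S → ℝ) (y : S × A) :
    M.moment b ν₀ (t + 1)
      (fun ω => c (stateAt t ω) (actionAt t ω) (stateAt (t + 1) ω) * Z ω) y =
    (∑ x : S × A, M.moment b ν₀ t Z x * (c x.1 x.2 y.1 * (M.P x.1 x.2 y.1).toReal)) *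
      (b y.1 y.2).toReal := by
  let ψ : S × A → Obs S A → ℝ := fun x o => c x.1 x.2 o.2.1 * if o.2 = y then 1 else 0
  have hψm : ∀ x, Measurable (ψ x) := fun x =>
    (measurable_of_finite fun p : S × A => c x.1 x.2 p.1 * if p = y then (1 : ℝ) else 0).comp
      measurable_snd
  have hψ : ∀ (x : S × A) s' a', Integrable (fun r => ψ x (r, s', a')) (M.rewardLaw x.1 x.2 s') :=
    fun x s' a' => by
      have := M.isProbabilityMeasure_rewardLaw x.1 x.2 s'
      exact integrable_const (c x.1 x.2 s' * if (s', a') = y then (1 : ℝ) else 0)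
  have key := (M.integrable_and_integral_step_mul b ν₀ hZ hψm
    fun x => M.integrable_stepLaw b x (hψm x) (hψ x)).2
  have e : ∀ ω : Path S A, c (stateAt t ω) (actionAt t ω) (stateAt (t + 1) ω) * Z ω *
      visit (t + 1) y ω = Z ω * ψ (ω t).2 (ω (t + 1)) := fun ω => by
    simp only [ψ, visit, stateAt, actionAt]; ring
  rw [MDP.moment]
  simp only [e]
  rw [key, Finset.sum_mul]
  refine Finset.sum_congr rfl fun x _ => ?_
  rw [M.integral_stepLaw b x (hψm x) (hψ x), ← Fintype.sum_prod_type', Finset.sum_eq_single y]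
  · have := M.isProbabilityMeasure_rewardLaw x.1 x.2 y.1
    simp [ψ]; ring
  · intro z _ hz
    simp [ψ, hz]
  · simp

theorem MDP.moment_add {t u : ℕ} {Z W : Path S A → ℝ} (hZ : IsHistoryFunction t Z)
    (hW : IsHistoryFunction t W) (htu : t ≤ u) (x : S × A) :
    M.moment b ν₀ u (fun ω => Z ω + W ω) x = M.moment b ν₀ u Z x + M.moment b ν₀ u W x := by
  simp only [MDP.moment, add_mul]
  exact integral_add (((hZ.mono htu).mul (isHistoryFunction_visit u x)).integrable _)
    (((hW.mono htu).mul (isHistoryFunction_visit u x)).integrable _)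

theorem MDP.moment_linearTrace_succ (c : S → A → S → ℝ) (e : S → ℝ) (z₀ : ℝ) (t : ℕ)
    (y : S × A) :
    M.moment b ν₀ (t + 1) (linearTrace c e z₀ (t + 1)) y =
    (∑ x : S × A, M.moment b ν₀ t (linearTrace c e z₀ t) x *
      (c x.1 x.2 y.1 * (M.P x.1 x.2 y.1).toReal)) * (b y.1 y.2).toReal +
      e y.1 * M.moment b ν₀ (t + 1) (fun _ => 1) y := by
  have hZ := isHistoryFunction_linearTrace (A := A) c e z₀ t
  rw [← M.moment_transition_mul b ν₀ hZ c y,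
    ← M.moment_current_mul b ν₀ (t + 1) (fun x => e x.1) (fun _ => 1) y,
    ← M.moment_add b ν₀ ((isHistoryFunction_transition t c).mul (hZ.mono t.le_succ))
      ((isHistoryFunction_of_current (t + 1) fun x => e x.1).mul (isHistoryFunction_const _ 1))
      le_rfl]
  simp only [mul_one]
  rfl

theorem MDP.moment_zero (z : ℝ) (x : S × A) :
    M.moment b ν₀ 0 (fun _ => z) x = z * ν₀.real {o | o.2 = x} := by
  rw [MDP.moment, integral_const_mul]
  congr 1
  have h : ∀ ω : Path S A, visit 0 x ω =
      ((fun ω : Path S A => ω 0) ⁻¹' {o | o.2 = x}).indicator (1 : Path S A → ℝ) ω := fun ω => by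
    simp [visit, Set.indicator]
  have hm : MeasurableSet {o : Obs S A | o.2 = x} := measurable_snd (measurableSet_singleton x)
  simp only [h]
  rw [integral_indicator_one (hm.preimage (by fun_prop)), measureReal_def, measureReal_def,
    ← Measure.map_apply (by fun_prop) hm]
  congr 2
  exact map_zero_trajMeasure (X := fun _ => Obs S A) (M.stepKernel b) ν₀

/-- Given `S_t`, the action `A_t` is drawn from `b S_t`. -/
theorem MDP.moment_one_pathLaw (ν : PMF S) (t : ℕ) (x : S × A) :
    M.moment b (startLaw b ν) t (fun _ => 1) x =
      (M.pathLaw b ν).real {ω | stateAt t ω = x.1} * (b x.1 x.2).toReal := by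
  have hfac : ∃ w : S → ℝ, ∀ x : S × A, M.moment b (startLaw b ν) t (fun _ => 1) x =
      w x.1 * (b x.1 x.2).toReal := by
    cases t with
    | zero => exact ⟨fun s => (ν s).toReal, fun x => by rw [M.moment_zero, startLaw_real, one_mul]⟩
    | succ t =>
      refine ⟨fun s => ∑ x : S × A, M.moment b (startLaw b ν) t (fun _ => 1) x *
        (1 * (M.P x.1 x.2 s).toReal), fun x => ?_⟩
      have := M.moment_transition_mul b (startLaw b ν) (isHistoryFunction_const t 1)
        (fun _ _ _ => 1) x
      simpa only [mul_one] using this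
  obtain ⟨w, hw⟩ := hfac
  rw [hw]
  congr 1
  have hb : ∑ a, (b x.1 a).toReal = 1 := by
    rw [← ENNReal.toReal_sum fun a _ => PMF.apply_ne_top _ _, pmf_sum_eq_one, ENNReal.toReal_one]
  have h1 : ∑ a, M.moment b (startLaw b ν) t (fun _ => 1) (x.1, a) = w x.1 := by
    simp only [hw, ← Finset.mul_sum, hb, mul_one]
  have hm : MeasurableSet {ω : Path S A | stateAt t ω = x.1} := by
    have : Measurable (stateAt t : Path S A → S) := by unfold stateAt; fun_prop
    exact this (measurableSet_singleton _)
  rw [← h1, ← integral_indicator_one hm]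
  simp only [MDP.moment]
  rw [← integral_finsetSum _ fun a _ =>
    ((isHistoryFunction_const t 1).mul (isHistoryFunction_visit t (x.1, a))).integrable _]
  refine integral_congr_ae (ae_of_all _ fun ω => ?_)
  by_cases h : (ω t).2.1 = x.1
  · simp [visit, stateAt, Prod.ext_iff, h]
  · simp [visit, stateAt, Prod.ext_iff, h]

end Moments

section SubstochasticMatrices

variable {X : Type*} [Fintype X] [DecidableEq X] {Q : Matrix X X ℝ}

theorem pow_apply_nonneg (h0 : ∀ i j, 0 ≤ Q i j) (n : ℕ) (i j : X) : 0 ≤ (Q ^ n) i j := by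
  induction n generalizing i j with
  | zero => rw [pow_zero, Matrix.one_apply]; split_ifs <;> norm_num
  | succ n ih =>
    rw [pow_succ, Matrix.mul_apply]
    exact Finset.sum_nonneg fun k _ => mul_nonneg (ih i k) (h0 k j)

/-- The powers of a substochastic matrix without eigenvalue `1` tend to zero. -/
theorem tendsto_pow_apply_zero (h0 : ∀ i j, 0 ≤ Q i j) (h1 : ∀ i, ∑ j, Q i j ≤ 1)
    (hu : IsUnit (1 - Q)) (i j : X) : Tendsto (fun n => (Q ^ n) i j) atTop (𝓝 0) := by
  let u : ℕ → X → ℝ := fun n => (Q ^ n).mulVec 1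
  have hu_apply : ∀ n i, u n i = ∑ j, (Q ^ n) i j := fun n i => by
    simp [u, Matrix.mulVec, dotProduct]
  have hanti : ∀ i, Antitone fun n => u n i := fun i => antitone_nat_of_succ_le fun n => by
    have : u (n + 1) i = ∑ k, (Q ^ n) i k * ∑ j, Q k j := by
      simp only [hu_apply, pow_succ, Matrix.mul_apply, Finset.mul_sum]
      exact Finset.sum_comm
    rw [this, hu_apply]
    exact Finset.sum_le_sum fun k _ =>
      mul_le_of_le_one_right (pow_apply_nonneg h0 n i k) (h1 k)
  have hnonneg : ∀ n i, 0 ≤ u n i := fun n i => by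
    rw [hu_apply]; exact Finset.sum_nonneg fun j _ => pow_apply_nonneg h0 n i j
  have hlim : Tendsto u atTop (𝓝 fun i => ⨅ n, u n i) := tendsto_pi_nhds.2 fun i =>
    tendsto_atTop_ciInf (hanti i) ⟨0, by rintro _ ⟨n, rfl⟩; exact hnonneg n i⟩
  set l : X → ℝ := fun i => ⨅ n, u n i
  have hfix : Q.mulVec l = l := by
    refine tendsto_nhds_unique (f := fun n => Q.mulVec (u n)) (l := atTop) ?_ ?_
    · have hc : Continuous fun v : X → ℝ => Q.mulVec v := continuous_const.matrix_mulVec continuous_id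
      exact (hc.tendsto l).comp hlim
    · have : (fun n => Q.mulVec (u n)) = fun n => u (n + 1) := by
        funext n
        simp only [u, Matrix.mulVec_mulVec, pow_succ']
      rw [this]
      exact hlim.comp (tendsto_add_atTop_nat 1)
  have hl : l = 0 := by
    have h : (1 - Q).mulVec l = 0 := by rw [Matrix.sub_mulVec, Matrix.one_mulVec, hfix, sub_self]
    have hdet := (Matrix.isUnit_iff_isUnit_det _).1 hu
    rw [← Matrix.one_mulVec l, ← Matrix.nonsing_inv_mul _ hdet, ← Matrix.mulVec_mulVec, h,
      Matrix.mulVec_zero]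
  rw [hl] at hlim
  refine squeeze_zero (fun n => pow_apply_nonneg h0 n i j) (fun n => ?_)
    ((tendsto_pi_nhds.1 hlim) i)
  rw [hu_apply]
  exact Finset.single_le_sum (fun k _ => pow_apply_nonneg h0 n i k) (Finset.mem_univ j)

/-- The Neumann series of a substochastic matrix without eigenvalue `1`. -/
theorem hasSum_pow_apply (h0 : ∀ i j, 0 ≤ Q i j) (h1 : ∀ i, ∑ j, Q i j ≤ 1)
    (hu : IsUnit (1 - Q)) (i j : X) : HasSum (fun n => (Q ^ n) i j) ((1 - Q)⁻¹ i j) := by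
  rw [hasSum_iff_tendsto_nat_of_nonneg fun n => pow_apply_nonneg h0 n i j]
  have hdet := (Matrix.isUnit_iff_isUnit_det _).1 hu
  have h : ∀ n, ∑ k ∈ Finset.range n, (Q ^ k) i j =
      (1 - Q)⁻¹ i j - ∑ k, (1 - Q)⁻¹ i k * (Q ^ n) k j := fun n => by
    have e : ∑ k ∈ Finset.range n, Q ^ k = (1 - Q)⁻¹ - (1 - Q)⁻¹ * Q ^ n := by
      rw [← Matrix.nonsing_inv_mul_cancel_left (1 - Q) (∑ k ∈ Finset.range n, Q ^ k) hdet,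
        mul_neg_geom_sum, Matrix.mul_sub, Matrix.mul_one]
    rw [← Matrix.mul_apply, ← Matrix.sub_apply, ← Matrix.sum_apply, e]
  simp only [h]
  have : Tendsto (fun n => ∑ k, (1 - Q)⁻¹ i k * (Q ^ n) k j) atTop
      (𝓝 (∑ k, (1 - Q)⁻¹ i k * 0)) := tendsto_finsetSum _ fun k _ =>
    (tendsto_pow_apply_zero h0 h1 hu k j).const_mul _
  simpa using this.const_sub ((1 - Q)⁻¹ i j)

/-- The solution of a linear recursion driven by a convergent input converges. -/
theorem tendsto_linear_recursion (h0 : ∀ i j, 0 ≤ Q i j) (h1 : ∀ i, ∑ j, Q i j ≤ 1)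
    (hu : IsUnit (1 - Q)) {f g : ℕ → X → ℝ} {l : X → ℝ} (hf0 : f 0 = 0)
    (hf : ∀ t, f (t + 1) = Matrix.vecMul (f t) Q + g (t + 1))
    (hg : ∀ i, Tendsto (fun t => g t i) atTop (𝓝 (l i))) (j : X) :
    Tendsto (fun t => f t j) atTop (𝓝 (Matrix.vecMul l (1 - Q)⁻¹ j)) := by
  have hsol : ∀ t, f t = ∑ k ∈ Finset.range t, Matrix.vecMul (g (t - k)) (Q ^ k) := by
    intro t
    induction t with
    | zero => simp [hf0]
    | succ t ih =>
      rw [hf, ih, Finset.sum_range_succ', Matrix.sum_vecMul]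
      simp [Matrix.vecMul_vecMul, pow_succ]
  have hterm : ∀ i, Tendsto
      (fun t => ∑' k, if k < t then g (t - k) i * (Q ^ k) i j else 0) atTop
      (𝓝 (l i * (1 - Q)⁻¹ i j)) := by
    intro i
    have hs := hasSum_pow_apply h0 h1 hu i j
    obtain ⟨C, hC⟩ := (hg i).norm.bddAbove_range
    rw [← (hs.mul_left (l i)).tsum_eq]
    refine tendsto_tsum_of_dominated_convergence (bound := fun k => C * (Q ^ k) i j)
      (hs.summable.mul_left C) (fun k => ?_) (Eventually.of_forall fun t k => ?_)
    · refine Tendsto.congr' ?_ (((hg i).comp (tendsto_sub_atTop_nat k)).mul_const ((Q ^ k) i j))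
      filter_upwards [eventually_gt_atTop k] with t ht
      simp [ht]
    · have hp := pow_apply_nonneg h0 k i j
      split_ifs
      · rw [norm_mul, Real.norm_of_nonneg hp]
        exact mul_le_mul_of_nonneg_right (hC ⟨_, rfl⟩) hp
      · rw [norm_zero]
        exact mul_nonneg ((norm_nonneg _).trans (hC ⟨0, rfl⟩)) hp
  have : ∀ t, f t j = ∑ i, ∑' k, if k < t then g (t - k) i * (Q ^ k) i j else 0 := by
    intro t
    have h : ∀ i, ∑' k, (if k < t then g (t - k) i * (Q ^ k) i j else 0) =
        ∑ k ∈ Finset.range t, g (t - k) i * (Q ^ k) i j := fun i => by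
      rw [tsum_eq_sum (s := Finset.range t) fun k hk => if_neg (by simpa using hk)]
      exact Finset.sum_congr rfl fun k hk => if_pos (Finset.mem_range.1 hk)
    simp only [h]
    rw [hsol, Finset.sum_apply, Finset.sum_comm]
    rfl
  simp only [this]
  exact tendsto_finsetSum _ fun i _ => hterm i

end SubstochasticMatrices

theorem sum_toReal_pmf {B : Type*} [Fintype B] (p : PMF B) : ∑ b, (p b).toReal = 1 := by
  rw [← ENNReal.toReal_sum fun b _ => PMF.apply_ne_top _ _, pmf_sum_eq_one, ENNReal.toReal_one]

section Values

variable {S A : Type*}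

/-- The discounted transition matrix on state-action pairs. -/
def MDP.pairMatrix (M : MDP S A) (π : S → PMF A) : Matrix (S × A) (S × A) ℝ :=
  Matrix.of fun x y => M.γ x.1 x.2 y.1 * (M.P x.1 x.2 y.1).toReal * (π y.1 y.2).toReal

theorem MDP.pairMatrix_nonneg (M : MDP S A) (π : S → PMF A) (x y : S × A) :
    0 ≤ M.pairMatrix π x y :=
  mul_nonneg (mul_nonneg (M.γ_nonneg _ _ _) ENNReal.toReal_nonneg) ENNReal.toReal_nonneg

theorem MDP.discMatrix_nonneg [Fintype A] (M : MDP S A) (π : S → PMF A) (s s' : S) :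
    0 ≤ M.discMatrix π s s' :=
  Finset.sum_nonneg fun _ _ => mul_nonneg (mul_nonneg ENNReal.toReal_nonneg ENNReal.toReal_nonneg)
    (M.γ_nonneg _ _ _)

/-- The mean reward of a transition. -/
def MDP.meanReward (M : MDP S A) (s : S) (a : A) (s' : S) : ℝ :=
  ∫ r, r ∂(M.rewardLaw s a s')

theorem MDP.prod_discountAfter_eq_linearTrace (M : MDP S A) (k : ℕ) (ω : Path S A) :
    ∏ j ∈ Finset.range k, M.discountAfter j ω = linearTrace M.γ (fun _ => 0) 1 k ω := by
  induction k with
  | zero => rfl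
  | succ k ih => rw [Finset.prod_range_succ, ih, linearTrace, add_zero, mul_comm]; rfl

theorem MDP.measurable_tdError_step [Fintype S] [MeasurableSpace S] [MeasurableSpace A]
    [MeasurableSingletonClass S] (M : MDP S A) (v : S → ℝ) (x : S × A) :
    Measurable fun o : Obs S A => o.1 + M.γ x.1 x.2 o.2.1 * v o.2.1 - v x.1 :=
  (measurable_fst.add ((measurable_of_finite fun s' : S => M.γ x.1 x.2 s' * v s').comp
    (measurable_fst.comp measurable_snd))).sub_const _

theorem MDP.integrable_tdError_reward (M : MDP S A) (v : S → ℝ) (x : S × A) (s' : S) :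
    Integrable (fun r => r + M.γ x.1 x.2 s' * v s' - v x.1) (M.rewardLaw x.1 x.2 s') := by
  have := M.isProbabilityMeasure_rewardLaw x.1 x.2 s'
  exact ((M.integrable_reward x.1 x.2 s').add (integrable_const _)).sub (integrable_const _)

variable [Fintype S] [Fintype A]

theorem MDP.integral_stepLaw_reward [MeasurableSpace S] [MeasurableSpace A]
    (M : MDP S A) (b : S → PMF A) (x : S × A) :
    ∫ o, o.1 ∂(M.stepLaw b x) =
      ∑ s', (M.P x.1 x.2 s').toReal * M.meanReward x.1 x.2 s' := by
  rw [M.integral_stepLaw b x measurable_fst fun s' a' => M.integrable_reward _ _ _]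
  refine Finset.sum_congr rfl fun s' _ => ?_
  change ∑ a', _ * _ * M.meanReward x.1 x.2 s' = _
  rw [← Finset.sum_mul, ← Finset.mul_sum, sum_toReal_pmf, mul_one]

theorem MDP.sum_pairMatrix_mul (M : MDP S A) (π : S → PMF A) (x : S × A) (q : S × A → ℝ) :
    ∑ y, M.pairMatrix π x y * q y = ∑ s', M.γ x.1 x.2 s' * (M.P x.1 x.2 s').toReal *
      ∑ a', (π s' a').toReal * q (s', a') := by
  rw [Fintype.sum_prod_type]
  refine Finset.sum_congr rfl fun s' _ => ?_
  rw [Finset.mul_sum]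
  exact Finset.sum_congr rfl fun a' _ => mul_assoc _ _ _

theorem MDP.sum_pairMatrix_le_one (M : MDP S A) (π : S → PMF A) (x : S × A) :
    ∑ y, M.pairMatrix π x y ≤ 1 := by
  have h := M.sum_pairMatrix_mul π x fun _ => 1
  simp only [mul_one, sum_toReal_pmf] at h
  rw [h, ← sum_toReal_pmf (M.P x.1 x.2)]
  exact Finset.sum_le_sum fun s' _ =>
    mul_le_of_le_one_left ENNReal.toReal_nonneg (M.γ_le_one _ _ _)

theorem MDP.sum_discMatrix_le_one (M : MDP S A) (π : S → PMF A) (s : S) :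
    ∑ s', M.discMatrix π s s' ≤ 1 := by
  simp only [MDP.discMatrix, Matrix.of_apply]
  rw [Finset.sum_comm, ← sum_toReal_pmf (π s)]
  refine Finset.sum_le_sum fun a _ => ?_
  calc ∑ s', (π s a).toReal * (M.P s a s').toReal * M.γ s a s'
      ≤ ∑ s', (π s a).toReal * (M.P s a s').toReal := Finset.sum_le_sum fun s' _ =>
        mul_le_of_le_one_right (mul_nonneg ENNReal.toReal_nonneg ENNReal.toReal_nonneg)
          (M.γ_le_one _ _ _)
    _ = (π s a).toReal := by rw [← Finset.mul_sum, sum_toReal_pmf, mul_one]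

variable [DecidableEq S] [DecidableEq A]

/-- If `I - P_{π,γ}` is invertible on states, then so is its analogue on state-action pairs. -/
theorem MDP.isUnit_one_sub_pairMatrix (M : MDP S A) {π : S → PMF A}
    (h : IsUnit (1 - M.discMatrix π)) : IsUnit (1 - M.pairMatrix π) := by
  let B : Matrix (S × A) S ℝ := Matrix.of fun x s' => M.γ x.1 x.2 s' * (M.P x.1 x.2 s').toReal
  let D : Matrix S (S × A) ℝ := Matrix.of fun s y => if y.1 = s then (π y.1 y.2).toReal else 0
  have hBD : M.pairMatrix π = B * D := by
    ext x y
    simp [MDP.pairMatrix, B, D, Matrix.mul_apply]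
  have hDB : M.discMatrix π = D * B := by
    ext s s'
    simp only [MDP.discMatrix, B, D, Matrix.mul_apply, Matrix.of_apply, Fintype.sum_prod_type]
    rw [Finset.sum_eq_single s]
    · refine Finset.sum_congr rfl fun a _ => ?_
      simp; ring
    · intro u _ hu
      simp [hu]
    · simp
  rw [Matrix.isUnit_iff_isUnit_det] at h ⊢
  rwa [hBD, Matrix.det_one_sub_mul_comm, ← hDB]

variable [MeasurableSpace S] [MeasurableSpace A]
  [MeasurableSingletonClass S] [MeasurableSingletonClass A]

/-- The vector `(I - Q)⁻¹ r` of state-action values. -/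
def MDP.pairValue (M : MDP S A) (π : S → PMF A) : S × A → ℝ :=
  Matrix.mulVec (1 - M.pairMatrix π)⁻¹
    fun x => ∑ s', (M.P x.1 x.2 s').toReal * M.meanReward x.1 x.2 s'

theorem MDP.moment_discount (M : MDP S A) (π : S → PMF A) (ν₀ : Measure (Obs S A))
    [IsProbabilityMeasure ν₀] (k : ℕ) (x : S × A) :
    M.moment π ν₀ k (linearTrace M.γ (fun _ => 0) 1 k) x =
      Matrix.vecMul (fun x => ν₀.real {o | o.2 = x}) (M.pairMatrix π ^ k) x := by
  induction k generalizing x with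
  | zero =>
    rw [pow_zero, Matrix.vecMul_one]
    exact (M.moment_zero π ν₀ 1 x).trans (one_mul _)
  | succ k ih =>
    rw [M.moment_linearTrace_succ, pow_succ, ← Matrix.vecMul_vecMul, zero_mul, add_zero,
      Finset.sum_mul]
    refine Finset.sum_congr rfl fun y _ => ?_
    rw [ih, mul_assoc]
    rfl

theorem MDP.integral_discountedReturn (M : MDP S A) {π : S → PMF A}
    (hu : IsUnit (1 - M.discMatrix π)) (ν₀ : Measure (Obs S A)) [IsProbabilityMeasure ν₀] :
    ∫ ω, M.discountedReturn ω ∂(M.law π ν₀) =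
      ∑ x, ν₀.real {o | o.2 = x} * M.pairValue π x := by
  have hQ := M.isUnit_one_sub_pairMatrix hu
  set w : S × A → ℝ := fun x => ν₀.real {o | o.2 = x}
  let F : ℕ → Path S A → ℝ := fun k ω => linearTrace M.γ (fun _ => 0) 1 k ω * (ω (k + 1)).1
  have hhist := fun k => isHistoryFunction_linearTrace (A := A) M.γ (fun _ => (0 : ℝ)) 1 k
  have hr : ∀ x, Integrable (fun o : Obs S A => o.1) (M.stepLaw π x) := fun x =>
    M.integrable_stepLaw π x measurable_fst fun s' a' => M.integrable_reward _ _ _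
  have hF := fun k => M.integrable_and_integral_step_mul π ν₀ (hhist k)
    (ψ := fun _ o => o.1) (fun _ => measurable_fst) hr
  have hFn := fun k => M.integrable_and_integral_step_mul π ν₀ (hhist k)
    (ψ := fun _ o => |o.1|) (fun _ => by fun_prop) fun x => (hr x).abs
  have hnn : ∀ k (ω : Path S A), 0 ≤ linearTrace M.γ (fun _ => 0) 1 k ω := fun k ω => by
    rw [← M.prod_discountAfter_eq_linearTrace]
    exact Finset.prod_nonneg fun j _ => M.γ_nonneg _ _ _
  have hsum : ∀ R : S × A → ℝ, HasSum
      (fun k => ∑ x, M.moment π ν₀ k (linearTrace M.γ (fun _ => 0) 1 k) x * R x)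
      (∑ x, Matrix.vecMul w (1 - M.pairMatrix π)⁻¹ x * R x) := fun R => by
    refine hasSum_sum fun x _ => HasSum.mul_right _ ?_
    simp only [M.moment_discount π ν₀]
    exact hasSum_sum fun y _ => (hasSum_pow_apply (M.pairMatrix_nonneg π)
      (M.sum_pairMatrix_le_one π) hQ y x).mul_left _
  have hmain := hasSum_integral_of_summable_integral_norm (F := F) (μ := M.law π ν₀)
    (fun k => (hF k).1) (by
      have : ∀ k, ∫ ω, ‖F k ω‖ ∂(M.law π ν₀) = _ := fun k => by
        refine Eq.trans ?_ (hFn k).2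
        refine integral_congr_ae (ae_of_all _ fun ω => ?_)
        simp only [F, norm_mul, Real.norm_eq_abs, abs_of_nonneg (hnn k ω)]
      simp only [this]
      exact (hsum _).summable)
  have e : ∀ k, ∫ ω, F k ω ∂(M.law π ν₀) = _ := fun k => (hF k).2
  simp only [e] at hmain
  have hG : (fun ω => ∑' k, F k ω) = M.discountedReturn := by
    funext ω
    rw [MDP.discountedReturn]
    simp only [M.prod_discountAfter_eq_linearTrace]
    rfl
  rw [hG] at hmain
  rw [hmain.unique (hsum _)]
  simp only [M.integral_stepLaw_reward]
  exact (Matrix.dotProduct_mulVec w _ _).symm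

theorem MDP.actionValue_eq (M : MDP S A) {π : S → PMF A}
    (hu : IsUnit (1 - M.discMatrix π)) (s : S) (a : A) :
    M.actionValue π s a = M.pairValue π (s, a) := by
  have h := M.integral_discountedReturn hu (Measure.dirac ((0, s, a) : Obs S A))
  rw [MDP.actionValue, MDP.pathLawFrom, h, Finset.sum_eq_single (s, a)]
  · have hm : MeasurableSet {o : Obs S A | o.2 = (s, a)} :=
      measurable_snd (measurableSet_singleton _)
    simp [measureReal_def, Measure.dirac_apply' _ hm]
  · intro y _ hy
    have hm : MeasurableSet {o : Obs S A | o.2 = y} := measurable_snd (measurableSet_singleton _)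
    simp [measureReal_def, Measure.dirac_apply' _ hm, hy.symm]
  · simp

theorem MDP.value_eq (M : MDP S A) {π : S → PMF A}
    (hu : IsUnit (1 - M.discMatrix π)) (s : S) :
    M.value π s = ∑ a, (π s a).toReal * M.actionValue π s a := by
  have h := M.integral_discountedReturn hu (startLaw π (PMF.pure s))
  rw [MDP.value, MDP.pathLaw, h, Fintype.sum_prod_type, Finset.sum_eq_single s]
  · simp [startLaw_real, M.actionValue_eq hu]
  · intro y _ hy
    simp [startLaw_real, PMF.pure_apply, hy]
  · simp

/-- The Bellman equation for the action values. -/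
theorem MDP.actionValue_bellman (M : MDP S A) {π : S → PMF A}
    (hu : IsUnit (1 - M.discMatrix π)) (s : S) (a : A) :
    M.actionValue π s a =
      ∑ s', (M.P s a s').toReal * (M.meanReward s a s' + M.γ s a s' * M.value π s') := by
  have hdet := (Matrix.isUnit_iff_isUnit_det _).1 (M.isUnit_one_sub_pairMatrix hu)
  have h : Matrix.mulVec (1 - M.pairMatrix π) (M.pairValue π) =
      fun x => ∑ s', (M.P x.1 x.2 s').toReal * M.meanReward x.1 x.2 s' := by
    rw [MDP.pairValue, Matrix.mulVec_mulVec, Matrix.mul_nonsing_inv _ hdet, Matrix.one_mulVec]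
  have h' := congrFun h (s, a)
  rw [Matrix.sub_mulVec, Matrix.one_mulVec, Pi.sub_apply, Matrix.mulVec, dotProduct,
    M.sum_pairMatrix_mul] at h'
  simp only [← M.actionValue_eq hu, ← M.value_eq hu] at h'
  rw [sub_eq_iff_eq_add] at h'
  rw [h', ← Finset.sum_add_distrib]
  exact Finset.sum_congr rfl fun s' _ => by ring

/-- The conditional mean of the temporal difference error is the advantage. -/
theorem MDP.integral_tdError_step (M : MDP S A) {π : S → PMF A} (b : S → PMF A)
    (hu : IsUnit (1 - M.discMatrix π)) (x : S × A) :
    ∫ o, (o.1 + M.γ x.1 x.2 o.2.1 * M.value π o.2.1 - M.value π x.1) ∂(M.stepLaw b x) =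
      M.actionValue π x.1 x.2 - M.value π x.1 := by
  rw [M.integral_stepLaw b x (M.measurable_tdError_step _ x)
    fun s' a' => M.integrable_tdError_reward _ x s', M.actionValue_bellman hu]
  have h : ∀ s', ∫ r, (r + M.γ x.1 x.2 s' * M.value π s' - M.value π x.1)
      ∂(M.rewardLaw x.1 x.2 s') =
      M.meanReward x.1 x.2 s' + M.γ x.1 x.2 s' * M.value π s' - M.value π x.1 := fun s' => by
    have := M.isProbabilityMeasure_rewardLaw x.1 x.2 s'
    rw [integral_sub (f := fun r => r + M.γ x.1 x.2 s' * M.value π s')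
      ((M.integrable_reward x.1 x.2 s').add (integrable_const _)) (integrable_const _),
      integral_add (M.integrable_reward x.1 x.2 s') (integrable_const _)]
    simp [MDP.meanReward]
  simp only [h, ← Finset.sum_mul, ← Finset.mul_sum, sum_toReal_pmf, mul_one, mul_sub,
    Finset.sum_sub_distrib, one_mul]

end Values

section Gradients

variable {B : Type*} {E : Type*} [NormedAddCommGroup E] [InnerProductSpace ℝ E] [CompleteSpace E]

/-- The likelihood ratio identity `p ∇ ln p = ∇p`, also where `p` vanishes. -/
theorem smul_gradient_log_pmf {p : E → PMF B} {b : B}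
    (hp : Differentiable ℝ fun ϑ => (p ϑ b).toReal) (θ : E) :
    (p θ b).toReal • gradient (fun ϑ => Real.log (p ϑ b).toReal) θ =
      gradient (fun ϑ => (p ϑ b).toReal) θ := by
  by_cases h : (p θ b).toReal = 0
  · have hmin : IsLocalMin (fun ϑ => (p ϑ b).toReal) θ :=
      Eventually.of_forall fun ϑ => by simp only [h]; exact ENNReal.toReal_nonneg
    rw [h, zero_smul, gradient, hmin.fderiv_eq_zero, map_zero]
  · rw [gradient, gradient, fderiv.log (hp θ) h, map_smul, smul_smul, mul_inv_cancel₀ h, one_smul]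

theorem sum_gradient_pmf [Fintype B] {p : E → PMF B}
    (hp : ∀ b, Differentiable ℝ fun ϑ => (p ϑ b).toReal) (θ : E) :
    ∑ b, gradient (fun ϑ => (p ϑ b).toReal) θ = 0 := by
  simp only [gradient]
  rw [← map_sum, ← fderiv_fun_sum fun b _ => hp b θ]
  simp only [sum_toReal_pmf]
  simp

end Gradients

section Emphasis

variable {S A : Type*}

theorem MDP.followOn_eq_linearTrace (M : MDP S A) (π μ : S → PMF A) (i : S → ℝ) (t : ℕ) :
    M.followOn π μ i t =
      linearTrace (fun s a s' => M.γ s a s' * ((π s a).toReal / (μ s a).toReal)) i 0 t := by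
  funext ω
  induction t with
  | zero => rfl
  | succ t ih => rw [MDP.followOn, ih]; rfl

theorem MDP.isHistoryFunction_followOn (M : MDP S A) (π μ : S → PMF A) (i : S → ℝ) (t : ℕ) :
    IsHistoryFunction t (M.followOn π μ i t) := by
  rw [M.followOn_eq_linearTrace]
  exact isHistoryFunction_linearTrace _ _ _ _

theorem MDP.isHistoryFunction_emphasis (M : MDP S A) (π μ : S → PMF A) (i : S → ℝ) (lam : ℝ)
    (t : ℕ) : IsHistoryFunction t (M.emphasis π μ i lam t) :=
  ((isHistoryFunction_const t (1 - lam)).mul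
    (isHistoryFunction_of_current t fun x => i x.1)).add
    ((isHistoryFunction_const t lam).mul (M.isHistoryFunction_followOn π μ i t))

theorem mul_ratio_of_coverage {π μ : S → PMF A} (hcov : ∀ s a, μ s a = 0 → π s a = 0) (s : S)
    (a : A) : (μ s a).toReal * ((π s a).toReal / (μ s a).toReal) = (π s a).toReal := by
  by_cases h : μ s a = 0
  · simp [h, hcov s a h]
  · exact mul_div_cancel₀ _ (ENNReal.toReal_ne_zero.2 ⟨h, PMF.apply_ne_top _ _⟩)

variable [Fintype S] [Fintype A] [DecidableEq S]

theorem MDP.emphaticWeightingTrace_apply (M : MDP S A) {π : S → PMF A}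
    (hu : IsUnit (1 - M.discMatrix π)) (d i : S → ℝ) (lam : ℝ) (s : S) :
    M.emphaticWeightingTrace π d i lam s =
      (1 - lam) * (d s * i s) + lam * M.emphaticWeighting π d i s := by
  have hdet := (Matrix.isUnit_iff_isUnit_det _).1 hu
  have h : (1 - M.discMatrix π)⁻¹ * (1 - (1 - lam) • M.discMatrix π) =
      (1 - lam) • (1 : Matrix S S ℝ) + lam • (1 - M.discMatrix π)⁻¹ := by
    have e : 1 - (1 - lam) • M.discMatrix π =
        (1 - lam) • (1 - M.discMatrix π) + lam • (1 : Matrix S S ℝ) := by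
      module
    rw [e, Matrix.mul_add, Matrix.mul_smul, Matrix.mul_smul, Matrix.nonsing_inv_mul _ hdet,
      Matrix.mul_one]
  rw [MDP.emphaticWeightingTrace, h, Matrix.vecMul_add, Matrix.vecMul_smul, Matrix.vecMul_smul,
    Matrix.vecMul_one]
  rfl

variable [MeasurableSpace S] [MeasurableSpace A]
  [MeasurableSingletonClass S] [MeasurableSingletonClass A]

/-- The vector `s ↦ E[F_t 1{S_t = s}]`, given by its recursion. -/
def MDP.followOnMean (M : MDP S A) (π μ : S → PMF A) (ν : PMF S) (i : S → ℝ) : ℕ → S → ℝ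
  | 0 => 0
  | t + 1 => Matrix.vecMul (M.followOnMean π μ ν i t) (M.discMatrix π) +
      fun s => (M.pathLaw μ ν).real {ω | stateAt (t + 1) ω = s} * i s

theorem MDP.moment_followOn [DecidableEq A] (M : MDP S A) {π μ : S → PMF A}
    (hcov : ∀ s a, μ s a = 0 → π s a = 0) (ν : PMF S) (i : S → ℝ) (t : ℕ) (x : S × A) :
    M.moment μ (startLaw μ ν) t (M.followOn π μ i t) x =
      M.followOnMean π μ ν i t x.1 * (μ x.1 x.2).toReal := by
  rw [M.followOn_eq_linearTrace]
  induction t generalizing x with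
  | zero =>
    refine (M.moment_zero μ (startLaw μ ν) 0 x).trans ?_
    simp [MDP.followOnMean]
  | succ t ih =>
    have h : ∑ y : S × A, M.followOnMean π μ ν i t y.1 * (μ y.1 y.2).toReal *
        (M.γ y.1 y.2 x.1 * ((π y.1 y.2).toReal / (μ y.1 y.2).toReal) *
          (M.P y.1 y.2 x.1).toReal) =
        Matrix.vecMul (M.followOnMean π μ ν i t) (M.discMatrix π) x.1 := by
      rw [Fintype.sum_prod_type]
      refine Finset.sum_congr rfl fun s _ => ?_
      change _ = _ * ∑ a, _ * _ * _
      rw [Finset.mul_sum]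
      refine Finset.sum_congr rfl fun a _ => ?_
      linear_combination (M.followOnMean π μ ν i t s * M.γ s a x.1 * (M.P s a x.1).toReal) *
        mul_ratio_of_coverage hcov s a
    rw [M.moment_linearTrace_succ]
    simp only [ih]
    rw [h, M.moment_one_pathLaw, MDP.followOnMean, Pi.add_apply]
    ring

theorem MDP.tendsto_followOnMean (M : MDP S A) {π μ : S → PMF A}
    (hu : IsUnit (1 - M.discMatrix π)) {ν : PMF S} {d : S → ℝ}
    (hd : M.IsLimitingDistribution μ ν d) (i : S → ℝ) (s : S) :
    Tendsto (fun t => M.followOnMean π μ ν i t s) atTop (𝓝 (M.emphaticWeighting π d i s)) :=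
  tendsto_linear_recursion (M.discMatrix_nonneg π) (M.sum_discMatrix_le_one π) hu
    (g := fun t s => (M.pathLaw μ ν).real {ω | stateAt t ω = s} * i s) rfl (fun _ => rfl)
    (fun s => (hd s).mul_const (i s)) s

theorem MDP.moment_emphasis [DecidableEq A] (M : MDP S A) {π μ : S → PMF A}
    (hcov : ∀ s a, μ s a = 0 → π s a = 0) (ν : PMF S) (i : S → ℝ) (lam : ℝ) (t : ℕ)
    (x : S × A) :
    M.moment μ (startLaw μ ν) t (M.emphasis π μ i lam t) x =
      ((1 - lam) * ((M.pathLaw μ ν).real {ω | stateAt t ω = x.1} * i x.1) +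
        lam * M.followOnMean π μ ν i t x.1) * (μ x.1 x.2).toReal := by
  have h := M.moment_add μ (startLaw μ ν)
    ((isHistoryFunction_of_current t fun x => (1 - lam) * i x.1).mul (isHistoryFunction_const t 1))
    ((isHistoryFunction_const t lam).mul (M.isHistoryFunction_followOn π μ i t)) le_rfl x
  rw [M.moment_const_mul, M.moment_current_mul μ (startLaw μ ν) t (fun x => (1 - lam) * i x.1),
    M.moment_followOn hcov, M.moment_one_pathLaw] at h
  simp only [mul_one] at h
  refine Eq.trans h ?_
  ring

/-- The actor update is integrable, with the mean obtained by conditioning on `(S_t, A_t)`. -/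
theorem MDP.integrable_and_integral_actorUpdate (M : MDP S A) {d : ℕ}
    {π : EuclideanSpace ℝ (Fin d) → S → PMF A}
    (hπ : ∀ s a, Differentiable ℝ (fun ϑ => (π ϑ s a).toReal))
    (θ : EuclideanSpace ℝ (Fin d)) {μ : S → PMF A} (hu : IsUnit (1 - M.discMatrix (π θ)))
    (hcov : ∀ s a, μ s a = 0 → π θ s a = 0) (ν : PMF S) (i : S → ℝ) (lam : ℝ) (t : ℕ) :
    Integrable (M.actorUpdate π θ μ i lam t) (M.pathLaw μ ν) ∧
    ∫ ω, M.actorUpdate π θ μ i lam t ω ∂(M.pathLaw μ ν) =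
      ∑ s, ((1 - lam) * ((M.pathLaw μ ν).real {ω | stateAt t ω = s} * i s) +
        lam * M.followOnMean (π θ) μ ν i t s) •
        ∑ a, M.actionValue (π θ) s a • gradient (fun ϑ => (π ϑ s a).toReal) θ := by
  classical
  let v := M.value (π θ)
  let ψ : S × A → Obs S A → ℝ := fun x o => o.1 + M.γ x.1 x.2 o.2.1 * v o.2.1 - v x.1
  let G : S × A → EuclideanSpace ℝ (Fin d) := fun x =>
    ((π θ x.1 x.2).toReal / (μ x.1 x.2).toReal) •
      gradient (fun ϑ => Real.log (π ϑ x.1 x.2).toReal) θ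
  have key := M.integrable_and_integral_step_smul μ (startLaw μ ν)
    (M.isHistoryFunction_emphasis (π θ) μ i lam t) (ψ := ψ) (M.measurable_tdError_step v)
    (fun x => M.integrable_stepLaw μ x (M.measurable_tdError_step v x)
      fun s' _ => M.integrable_tdError_reward v x s') G
  have hupd : M.actorUpdate π θ μ i lam t = fun ω =>
      (M.emphasis (π θ) μ i lam t ω * ψ (ω t).2 (ω (t + 1))) • G (ω t).2 := by
    funext ω
    simp only [G, smul_smul, MDP.actorUpdate]
    congr 1
    simp only [ψ, v, ratioAt, MDP.tdError, MDP.discountAfter, stateAt, actionAt, rewardAt]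
    ring
  rw [hupd]
  refine ⟨key.1, key.2.trans ?_⟩
  have hG : ∀ s a, (μ s a).toReal • G (s, a) = gradient (fun ϑ => (π ϑ s a).toReal) θ :=
    fun s a => by
      simp only [G, smul_smul]
      rw [mul_ratio_of_coverage hcov, smul_gradient_log_pmf (p := fun ϑ => π ϑ s) (hπ s a)]
  rw [Fintype.sum_prod_type]
  refine Finset.sum_congr rfl fun s _ => ?_
  set m := (1 - lam) * ((M.pathLaw μ ν).real {ω | stateAt t ω = s} * i s) +
    lam * M.followOnMean (π θ) μ ν i t s with hm
  have hterm : ∀ a, (M.moment μ (startLaw μ ν) t (M.emphasis (π θ) μ i lam t) (s, a) *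
      ∫ o, ψ (s, a) o ∂(M.stepLaw μ (s, a))) • G (s, a) =
      m • (M.actionValue (π θ) s a • gradient (fun ϑ => (π ϑ s a).toReal) θ -
        v s • gradient (fun ϑ => (π ϑ s a).toReal) θ) := fun a => by
    rw [M.moment_emphasis hcov, M.integral_tdError_step μ hu (s, a), ← sub_smul, ← hG, ← hm]
    generalize G (s, a) = g
    module
  simp only [hterm]
  rw [← Finset.smul_sum, Finset.sum_sub_distrib, ← Finset.smul_sum (r := v s),
    sum_gradient_pmf (p := fun ϑ => π ϑ s) (hπ s), smul_zero, sub_zero]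

end Emphasis

end OffPolicy

end

theorem proposition1 {S A : Type*} [Fintype S] [DecidableEq S] [MeasurableSpace S]
    [MeasurableSingletonClass S] [Fintype A] [MeasurableSpace A] [MeasurableSingletonClass A]
    (M : OffPolicy.MDP S A) {d : ℕ}
    (π : EuclideanSpace ℝ (Fin d) → S → PMF A)
    (hπ : ∀ s a, Differentiable ℝ (fun ϑ => (π ϑ s a).toReal))
    (θ : EuclideanSpace ℝ (Fin d)) (μ : S → PMF A)
    (hYu : M.YuConditions (π θ) μ)
    (ν : PMF S) (dμ : S → ℝ) (hdμ : M.IsLimitingDistribution μ ν dμ)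
    (i : S → ℝ) (hi : ∀ s, 0 ≤ i s) :
    (∀ lam ∈ Set.Icc (0 : ℝ) 1,
      (∀ t, Integrable (M.actorUpdate π θ μ i lam t) (M.pathLaw μ ν)) ∧
      Tendsto (fun t => ∫ ω, M.actorUpdate π θ μ i lam t ω ∂(M.pathLaw μ ν)) atTop
        (𝓝 (∑ s, M.emphaticWeightingTrace (π θ) dμ i lam s •
          ∑ a, M.actionValue (π θ) s a • gradient (fun ϑ => (π ϑ s a).toReal) θ))) ∧
    Tendsto (fun t => ∫ ω, M.actorUpdate π θ μ i 1 t ω ∂(M.pathLaw μ ν)) atTop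
      (𝓝 (∑ s, M.emphaticWeighting (π θ) dμ i s •
        ∑ a, M.actionValue (π θ) s a • gradient (fun ϑ => (π ϑ s a).toReal) θ)) := by
  have hlim : ∀ lam, Tendsto (fun t => ∫ ω, M.actorUpdate π θ μ i lam t ω ∂(M.pathLaw μ ν)) atTop
      (𝓝 (∑ s, M.emphaticWeightingTrace (π θ) dμ i lam s •
        ∑ a, M.actionValue (π θ) s a • gradient (fun ϑ => (π ϑ s a).toReal) θ)) := fun lam => by
    simp only [fun t => (M.integrable_and_integral_actorUpdate hπ θ hYu.isUnit hYu.coverage ν i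
      lam t).2, M.emphaticWeightingTrace_apply hYu.isUnit]
    exact tendsto_finsetSum _ fun s _ => ((((hdμ s).mul_const (i s)).const_mul (1 - lam)).add
      ((M.tendsto_followOnMean hYu.isUnit hdμ i s).const_mul lam)).smul_const _
  refine ⟨fun lam _ => ⟨fun t => (M.integrable_and_integral_actorUpdate hπ θ hYu.isUnit
    hYu.coverage ν i lam t).1, hlim lam⟩, ?_⟩
  have h := hlim 1
  simpa only [M.emphaticWeightingTrace_apply hYu.isUnit, sub_self, zero_mul, one_mul,
    zero_add] using h
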